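/- A \emph{semiring} $(S,+,\cdot)$ is a nonempty set with two associative operations such that $\cdot$ distributes over $+$ on both sides (addition need not be commutative, and no zero or identity is required); rings are associative and need not have an identity. A semiring is \emph{idempotent} if $x+x=x=x\cdot x$ for all $x$. On an idempotent semiring put \[ a\,\mathcal D^+\,b \iff a+b+a=a,\ b+a+b=b;\qquad a\,\mathcal L^+\,b \iff a+b=a,\ b+a=b;\qquad a\,\mathcal R^+\,b \iff a+b=b,\ b+a=a. \] An idempotent semiring is called a \emph{band semiring} [\emph{left band semiring}, \emph{right band semiring}] if $\mathcal D^+$ [$\mathcal L^+$, $\mathcal R^+$] is its least distributive lattice congruence. A semiring is \emph{completely regular} if it is a union of subsemirings that are rings. A completely regular semiring $S$ is a \emph{band orthoring} [\emph{left band orthoring}, \emph{right band orthoring}] if the set $E^+(S)=\{e\in S: e+e=e\}$ is a subsemiring of $S$ and is a band semiring [left band semiring, right band semiring]. Regard completely regular semirings as algebras $(S,+,\cdot,{}')$ of type $(2,2,1)$, where $x'$ is the inverse of $x$ in the maximal subgroup of $(S,+)$ containing $x$ (equivalently, $x+x'+x=x$, $x+x'=x'+x$, $(x')'=x$ for all $x$).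 A \emph{variety} is a class of algebras of this type defined by a set of identities, and the \emph{join} $\mathbf V\vee\mathbf W$ of two varieties is the least variety containing both. \textbf{Theorem.} The classes $\mathbf{BOR}$, $\mathbf{LBOR}$, $\mathbf{RBOR}$ of all band orthorings, all left band orthorings and all right band orthorings are varieties, and \[ \mathbf{BOR}=\mathbf{LBOR}\vee\mathbf{RBOR}. \] -/

import Mathlib

universe u

namespace BandOrthoring

/-! ### Semirings (addition need not be commutative, no zero and no one) -/

/-- `(S, +, ·)` is a semiring: both reducts are semigroups and multiplication distributes over
addition on both sides. -/
structure IsSemiring (S : Type u) [Add S] [Mul S] : Prop where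
  add_assoc : ∀ x y z : S, (x + y) + z = x + (y + z)
  mul_assoc : ∀ x y z : S, (x * y) * z = x * (y * z)
  left_distrib : ∀ x y z : S, x * (y + z) = x * y + x * z
  right_distrib : ∀ x y z : S, (x + y) * z = x * z + y * z

/-- A subset closed under both operations; it carries the restricted operations. -/
structure Subsemiring (S : Type u) [Add S] [Mul S] where
  carrier : Set S
  add_mem : ∀ x ∈ carrier, ∀ y ∈ carrier, x + y ∈ carrier
  mul_mem : ∀ x ∈ carrier, ∀ y ∈ carrier, x * y ∈ carrier

namespace Subsemiring

variable {S : Type u} [Add S] [Mul S]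

/-- The elements of a subsemiring, as a type. -/
def Elem (T : Subsemiring S) : Type u := {x : S // x ∈ T.carrier}

instance (T : Subsemiring S) : Add T.Elem :=
  ⟨fun x y => ⟨x.1 + y.1, T.add_mem x.1 x.2 y.1 y.2⟩⟩

instance (T : Subsemiring S) : Mul T.Elem :=
  ⟨fun x y => ⟨x.1 * y.1, T.mul_mem x.1 x.2 y.1 y.2⟩⟩

end Subsemiring

/-- `(R, +, ·)` is an associative ring, not necessarily with an identity. -/
structure IsRing (R : Type u) [Add R] [Mul R] : Prop extends IsSemiring R where
  add_comm : ∀ x y : R, x + y = y + x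
  exists_zero_neg : ∃ z : R, (∀ x : R, z + x = x) ∧ ∀ x : R, ∃ y : R, x + y = z

/-- A completely regular semiring: a semiring which is a union of rings (subsemirings that are
rings under the restricted operations). -/
structure IsCompletelyRegular (S : Type u) [Add S] [Mul S] : Prop extends IsSemiring S where
  union_of_rings : ∀ x : S, ∃ R : Subsemiring S, x ∈ R.carrier ∧ IsRing R.Elem

/-! ### Idempotent semirings and band semirings -/

/-- An idempotent semiring: both reducts are bands. -/
structure IsIdempotentSemiring (S : Type u) [Add S] [Mul S] : Prop extends IsSemiring S where
  add_self : ∀ x : S, x + x = x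
  mul_self : ∀ x : S, x * x = x

/-- A semiring whose operations are the join and the meet of a distributive lattice. -/
structure IsDistributiveLattice (S : Type u) [Add S] [Mul S] : Prop
    extends IsIdempotentSemiring S where
  add_comm : ∀ x y : S, x + y = y + x
  mul_comm : ∀ x y : S, x * y = y * x
  add_absorb : ∀ x y : S, x + x * y = x
  mul_absorb : ∀ x y : S, x * (x + y) = x

/-- Green's relation `𝓓⁺` of the additive reduct of an idempotent semiring. -/
def DPlus {S : Type u} [Add S] (a b : S) : Prop := a + b + a = a ∧ b + a + b = b

/-- Green's relation `𝓛⁺` of the additive reduct of an idempotent semiring. -/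
def LPlus {S : Type u} [Add S] (a b : S) : Prop := a + b = a ∧ b + a = b

/-- Green's relation `𝓡⁺` of the additive reduct of an idempotent semiring. -/
def RPlus {S : Type u} [Add S] (a b : S) : Prop := a + b = b ∧ b + a = a

/-- The relation `r` is the least distributive lattice congruence on `S`. A `RingCon` is an
equivalence relation compatible with `+` and `*`. -/
def IsLeastDistributiveLatticeCongruence (S : Type u) [Add S] [Mul S] (r : S → S → Prop) : Prop :=
  ∃ c : RingCon S, (∀ a b : S, c a b ↔ r a b) ∧
    IsLeast {d : RingCon S | IsDistributiveLattice d.Quotient} c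

/-- A band semiring: an idempotent semiring on which `𝓓⁺` is the least distributive lattice
congruence. -/
def IsBandSemiring (S : Type u) [Add S] [Mul S] : Prop :=
  IsIdempotentSemiring S ∧ IsLeastDistributiveLatticeCongruence S DPlus

/-- A left band semiring: an idempotent semiring on which `𝓛⁺` is the least distributive lattice
congruence. -/
def IsLeftBandSemiring (S : Type u) [Add S] [Mul S] : Prop :=
  IsIdempotentSemiring S ∧ IsLeastDistributiveLatticeCongruence S LPlus

/-- A right band semiring: an idempotent semiring on which `𝓡⁺` is the least distributive lattice
congruence. -/
def IsRightBandSemiring (S : Type u) [Add S] [Mul S] : Prop :=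
  IsIdempotentSemiring S ∧ IsLeastDistributiveLatticeCongruence S RPlus

/-! ### Band orthorings -/

/-- The set `E⁺(S)` of additive idempotents. -/
def addIdempotents (S : Type u) [Add S] : Set S := {e | e + e = e}

/-- A band orthoring: a completely regular semiring `S` such that `E⁺(S)` is a subsemiring and is
a band semiring. -/
def IsBandOrthoring (S : Type u) [Add S] [Mul S] : Prop :=
  IsCompletelyRegular S ∧
    ∃ T : Subsemiring S, T.carrier = addIdempotents S ∧ IsBandSemiring T.Elem

/-- A left band orthoring: `E⁺(S)` is a left band semiring. -/
def IsLeftBandOrthoring (S : Type u) [Add S] [Mul S] : Prop :=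
  IsCompletelyRegular S ∧
    ∃ T : Subsemiring S, T.carrier = addIdempotents S ∧ IsLeftBandSemiring T.Elem

/-- A right band orthoring: `E⁺(S)` is a right band semiring. -/
def IsRightBandOrthoring (S : Type u) [Add S] [Mul S] : Prop :=
  IsCompletelyRegular S ∧
    ∃ T : Subsemiring S, T.carrier = addIdempotents S ∧ IsRightBandSemiring T.Elem

/-! ### Varieties of algebras of type `(2, 2, 1)` -/

/-- A nonempty algebra `(S, +, ·, ')` of type `(2, 2, 1)`, with no laws imposed. The unary
operation is written `-`. -/
structure Alg : Type (u + 1) where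
  carrier : Type u
  [nonempty : Nonempty carrier]
  [add : Add carrier]
  [mul : Mul carrier]
  [neg : Neg carrier]

attribute [instance] Alg.nonempty Alg.add Alg.mul Alg.neg

/-- Terms of type `(2, 2, 1)` in countably many variables. -/
inductive Term : Type
  | var : ℕ → Term
  | add : Term → Term → Term
  | mul : Term → Term → Term
  | neg : Term → Term

/-- The value of a term under an assignment of the variables. -/
def Term.eval {S : Type u} [Add S] [Mul S] [Neg S] (v : ℕ → S) : Term → S
  | .var n => v n
  | .add s t => s.eval v + t.eval v
  | .mul s t => s.eval v * t.eval v
  | .neg t => -t.eval v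

/-- The algebra `A` satisfies the identity `p.1 ≈ p.2`. -/
def Satisfies (A : Alg.{u}) (p : Term × Term) : Prop :=
  ∀ v : ℕ → A.carrier, p.1.eval v = p.2.eval v

/-- A variety: a class of algebras defined by a set of identities. -/
def IsVariety (K : Set Alg.{u}) : Prop :=
  ∃ E : Set (Term × Term), K = {A | ∀ p ∈ E, Satisfies A p}

/-- The join of two classes in the lattice of varieties: the intersection of all varieties
containing both of them. -/
def varietyJoin (K L : Set Alg.{u}) : Set Alg.{u} :=
  ⋂₀ {V | IsVariety V ∧ K ⊆ V ∧ L ⊆ V}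

/-- In a completely regular semiring these laws say that `-x` is the inverse of `x` in the
maximal subgroup of `(S, +)` containing `x`. -/
structure IsInverseOperation (S : Type u) [Add S] [Neg S] : Prop where
  add_neg_add : ∀ x : S, x + -x + x = x
  add_neg_comm : ∀ x : S, x + -x = -x + x
  neg_neg : ∀ x : S, -(-x) = x

/-- The class of band orthorings, as algebras `(S, +, ·, ')`. -/
def BOR : Set Alg.{u} :=
  {A | IsBandOrthoring A.carrier ∧ IsInverseOperation A.carrier}

/-- The class of left band orthorings, as algebras `(S, +, ·, ')`. -/
def LBOR : Set Alg.{u} :=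
  {A | IsLeftBandOrthoring A.carrier ∧ IsInverseOperation A.carrier}

/-- The class of right band orthorings, as algebras `(S, +, ·, ')`. -/
def RBOR : Set Alg.{u} :=
  {A | IsRightBandOrthoring A.carrier ∧ IsInverseOperation A.carrier}

end BandOrthoring

/-! Among idempotent semirings, band semirings are those satisfying `x + x * y + x = x` and `x + y *
x + x = x`. The left and right ones satisfy in addition `a + b + a = a + b` and `a + b + a = b + a`
respectively. With `idem x = x + -x`, these laws become identities on `E⁺`. Being a union of rings
is also equational: the subalgebra generated by `x` must be a ring with zero `idem x`, which is a
family of identities in one variable. Hence all three classes are varieties.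

For the join, a band orthoring is decomposed by two congruences. The first relates `a` and `b` when
`a = b + idem a` and `b = a + idem b`; on idempotents it is `𝓡⁺`, so its quotient is a left band
orthoring. The second is its mirror image under reversal of addition. Their intersection is
equality, because `𝓛⁺ ∩ 𝓡⁺` is trivial on idempotents. An identity valid in both quotients therefore
holds in the whole algebra.

The work lies in showing that the first relation is a congruence. Two facts carry it: `idem` is a
homomorphism (`OrthoringLaws.idem_add_eq`), and `𝓡⁺` is compatible with right addition
(`BandLaws.RPlus_add_right`). Neither is a matter of addition alone; both come from expanding
products by distributivity. -/

namespace BandOrthoring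

/-! ### Band semirings and Green's relations of their additive bands -/

section Band

variable {S : Type u} [Add S] [Mul S]

/-- The absorption identities characterizing band semirings among idempotent semirings. -/
structure BandLaws (S : Type u) [Add S] [Mul S] : Prop extends IsIdempotentSemiring S where
  absorb_right : ∀ x y : S, x + x * y + x = x
  absorb_left : ∀ x y : S, x + y * x + x = x

theorem IsIdempotentSemiring.add_self_add (h : IsIdempotentSemiring S) (x y : S) :
    x + (x + y) = x + y := by
  rw [← h.add_assoc, h.add_self]

namespace BandLaws

/-- The relation `c + b + c = c` is the `𝓙`-preorder of the additive band, with `c` below `b`; it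
holds as soon as `b` occurs as a summand of `c`. -/
theorem eq_add_of_add (h : IsIdempotentSemiring S) {b c u v : S} (hc : c = u + b + v) :
    c + b + c = c := by
  have h1 : c + b + v = c := by
    have := h.add_self (b + v)
    rw [hc]; simp only [h.add_assoc] at *
    rw [this]
  calc c + b + c = c + b + (c + b + v) := by rw [h1]
    _ = (c + b) + (c + b) + v := by simp only [h.add_assoc]
    _ = c := by rw [h.add_self, h1]

theorem below_trans (h : IsIdempotentSemiring S) {a b c : S} (hab : a + b + a = a)
    (hbc : b + c + b = b) : a + c + a = a := by
  refine eq_add_of_add h (u := a + b) (v := b + a) ?_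
  calc a = a + b + a := hab.symm
    _ = a + (b + c + b) + a := by rw [hbc]
    _ = _ := by simp only [h.add_assoc]

/-- The `𝓓⁺`-classes of a band form a semilattice. Here `a` equals `a + (c + a + b) + a`, so it lies
below `c + a + b`, which lies below its cyclic shift `b + c + a` and hence below `b + c`. -/
theorem below_add (h : IsIdempotentSemiring S) {a b c : S} (hb : a + b + a = a)
    (hc : a + c + a = a) : a + (b + c) + a = a := by
  have h1 : (c + a + b) + (b + c) + (c + a + b) = c + a + b := by
    have h2 : (b + c + a) + (b + c) + (b + c + a) = b + c + a :=
      eq_add_of_add h (u := b + c) (v := a) (by rw [h.add_self])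
    have h3 : (c + a + b) + (b + c + a) + (c + a + b) = c + a + b := by
      refine eq_add_of_add h (u := c + a) (v := b + (c + a + b)) ?_
      have hb := h.add_self b
      have h4 := h.add_self (c + a + b)
      simp only [h.add_assoc] at *
      grind
    exact below_trans h h3 h2
  have h2 : a + (c + a + b) + a = a := by
    refine eq_add_of_add h (u := a) (v := a) ?_
    simp only [h.add_assoc] at *
    grind
  exact below_trans h h2 h1

/-- Elements of a `𝓓⁺`-class add as in a rectangular band. -/
theorem rectangular (h : IsIdempotentSemiring S) {p q t : S} (ht : p + t + p = p)
    (hq : p + q + p = p) (hp : q + p + q = q) : p + t + q = p + q := by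
  have h1 : q + t + q = q := below_trans h hp ht
  calc p + t + q = (p + q + p) + t + (q + p + q) := by rw [hp, hq]
    _ = p + (q + (p + t + q) + p) + q := by simp only [h.add_assoc]
    _ = p + q := by
      have h2 : q + (p + t) + q = q := below_add h hp h1
      simp only [h.add_assoc] at *
      grind

theorem DPlus_add (h : IsIdempotentSemiring S) {a b c d : S} (hab : DPlus a b)
    (hcd : DPlus c d) : DPlus (a + c) (b + d) := by
  have key : ∀ {a b c d : S}, a + b + a = a → c + d + c = c →
      (a + c) + (b + d) + (a + c) = a + c := by
    intro a b c d hab hcd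
    refine below_add h (below_trans h ?_ hab) (below_trans h ?_ hcd)
    · exact eq_add_of_add h (u := a) (v := c) (by rw [h.add_self])
    · exact eq_add_of_add h (u := a) (v := c) (by rw [h.add_assoc a c c, h.add_self])
  exact ⟨key hab.1 hcd.1, key hab.2 hcd.2⟩

theorem DPlus_mul (h : IsIdempotentSemiring S) {a b c d : S} (hab : DPlus a b)
    (hcd : DPlus c d) : DPlus (a * c) (b * d) := by
  have key : ∀ {a b c d : S}, a + b + a = a → c + d + c = c →
      a * c + b * d + a * c = a * c := by
    intro a b c d hab hcd
    refine below_trans h (b := b * c) ?_ ?_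
    · rw [← h.right_distrib, ← h.right_distrib, hab]
    · rw [← h.left_distrib, ← h.left_distrib, hcd]
  exact ⟨key hab.1 hcd.1, key hab.2 hcd.2⟩

/-- Green's relation `𝓓⁺` as a congruence. -/
def congruenceD (h : IsIdempotentSemiring S) : RingCon S where
  r := DPlus
  iseqv := ⟨fun x => by simp [DPlus, h.add_self], fun h => ⟨h.2, h.1⟩,
    fun h1 h2 => ⟨below_trans h h1.1 h2.1, below_trans h h2.2 h1.2⟩⟩
  mul' := DPlus_mul h
  add' := DPlus_add h

theorem isDistributiveLattice (h : BandLaws S) :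
    IsDistributiveLattice (congruenceD h.toIsIdempotentSemiring).Quotient := by
  set c := congruenceD h.toIsIdempotentSemiring
  have hc : ∀ {a b : S}, DPlus a b → (a : c.Quotient) = b := fun hab => c.eq.2 hab
  -- Absorption puts `a * b` below `a * b * a`, and that below `b * a * b * a = b * a`.
  have comm : ∀ a b : S, a * b + b * a + a * b = a * b := by
    intro a b
    have h1 := below_trans h.toIsIdempotentSemiring (h.absorb_right (a * b) a)
      (h.absorb_left (a * b * a) b)
    rwa [show b * (a * b * a) = b * a by
      rw [h.mul_assoc, ← h.mul_assoc, h.mul_self]] at h1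
  have absorb : ∀ a b : S, DPlus (a + a * b) a := by
    intro a b
    have h1 := h.absorb_right a b
    have h2 := h.add_self (a + a * b)
    constructor <;> simp only [h.add_assoc, h.add_self_add] at * <;> grind
  refine
    { add_assoc := ?_, mul_assoc := ?_, left_distrib := ?_, right_distrib := ?_
      add_self := ?_, mul_self := ?_, add_comm := ?_, mul_comm := ?_
      add_absorb := ?_, mul_absorb := ?_ }
  · rintro ⟨x⟩ ⟨y⟩ ⟨z⟩; exact congrArg _ (h.add_assoc x y z)
  · rintro ⟨x⟩ ⟨y⟩ ⟨z⟩; exact congrArg _ (h.mul_assoc x y z)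
  · rintro ⟨x⟩ ⟨y⟩ ⟨z⟩; exact congrArg _ (h.left_distrib x y z)
  · rintro ⟨x⟩ ⟨y⟩ ⟨z⟩; exact congrArg _ (h.right_distrib x y z)
  · rintro ⟨x⟩; exact congrArg _ (h.add_self x)
  · rintro ⟨x⟩; exact congrArg _ (h.mul_self x)
  · rintro ⟨x⟩ ⟨y⟩
    have h3 := h.add_self (x + y)
    have h4 := h.add_self (y + x)
    refine hc (a := x + y) (b := y + x) ?_
    constructor <;> simp only [h.add_assoc, h.add_self_add] at * <;> assumption
  · rintro ⟨x⟩ ⟨y⟩; exact hc ⟨comm x y, comm y x⟩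
  · rintro ⟨x⟩ ⟨y⟩; exact hc (absorb x y)
  · rintro ⟨x⟩ ⟨y⟩
    refine hc (a := x * (x + y)) (b := x) ?_
    rw [h.left_distrib, h.mul_self]
    exact absorb x y

theorem isLeast (h : BandLaws S) : IsLeastDistributiveLatticeCongruence S DPlus := by
  refine ⟨congruenceD h.toIsIdempotentSemiring, fun _ _ => Iff.rfl, h.isDistributiveLattice, ?_⟩
  intro d hd a b hab
  have hd : IsDistributiveLattice d.Quotient := hd
  have h1 : ((a + b + a : S) : d.Quotient) = a := by rw [hab.1]
  have h2 : ((b + a + b : S) : d.Quotient) = b := by rw [hab.2]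
  simp only [RingCon.coe_add] at h1 h2
  refine d.eq.1 ?_
  rw [hd.add_comm (b : d.Quotient) a, hd.add_assoc, hd.add_self] at h2
  rw [hd.add_comm, ← hd.add_assoc, hd.add_self] at h1
  exact h1.symm.trans h2

/-- In a band semiring `𝓡⁺`-related elements have the same sum with an element below them. -/
theorem add_eq_add_of_RPlus (h : BandLaws S) {e f k : S} (hef : e + f = f) (hfe : f + e = e)
    (hk : k + e + k = k) : e + k = f + k := by
  have hI := h.toIsIdempotentSemiring
  have hfk : k + f + k = k := below_trans hI hk (by rw [hef, hfe])
  have rect : ∀ {p q t : S}, DPlus e p → DPlus e q → DPlus e t → p + t + q = p + q := by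
    intro p q t hp hq ht
    exact rectangular hI (below_trans hI hp.2 ht.1) (below_trans hI hp.2 hq.1)
      (below_trans hI hq.2 hp.1)
  -- When `k` is below `x`, the products `x * k` and `k * x` are `𝓓⁺`-equivalent to `x`: absorption
  -- gives one half, and writing `x = x * x` and distributing gives the other. Sums of such products
  -- then collapse by `rectangular`.
  have right : ∀ {x : S}, k + x + k = k → DPlus x (x * k) := fun {x} hx =>
    ⟨h.absorb_right _ _, by
      conv_lhs => enter [1, 2]; rw [← h.mul_self x]
      rw [← h.left_distrib, ← h.left_distrib, hx]⟩
  have left : ∀ {x : S}, k + x + k = k → DPlus x (k * x) := fun {x} hx =>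
    ⟨h.absorb_left _ _, by
      conv_lhs => enter [1, 2]; rw [← h.mul_self x]
      rw [← h.right_distrib, ← h.right_distrib, hx]⟩
  have hDf : DPlus e f := by simp only [DPlus, hef, hfe, and_self]
  have trans : ∀ {x : S}, DPlus f x → DPlus e x := fun hx =>
    ⟨below_trans hI hDf.1 hx.1, below_trans hI hx.2 hDf.2⟩
  have he : DPlus e e := by simp only [DPlus, h.add_self, and_self]
  have hek := right hk
  have hke := left hk
  have hkf := trans (left hfk)
  have hfe1 : e * f + e = e := by
    conv_lhs => enter [2]; rw [← h.mul_self e]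
    rw [← h.left_distrib, hfe, h.mul_self]
  have hfe2 : e + e * f = e * f := by
    conv_lhs => enter [1]; rw [← h.mul_self e]
    rw [← h.left_distrib, hef]
  have hef' : DPlus e (e * f) := by simp only [DPlus, hfe1, hfe2, and_self]
  have h1 : e + k = e + e * k + k := by
    calc e + k = (e + k) * (e + k) := (h.mul_self _).symm
      _ = e + k * e + e * k + k := by
        simp only [h.left_distrib, h.right_distrib, h.mul_self, h.add_assoc]
      _ = e + e * k + k := by rw [rect he hek hke]
  have h2 : f + k = f + k * f + k := by
    calc f + k = (f + k) * (f + k) := (h.mul_self _).symm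
      _ = f + f * k + k * f + k := by
        rw [h.right_distrib, h.left_distrib, h.left_distrib, h.mul_self, h.mul_self, h.add_assoc,
          h.add_assoc, h.add_assoc]
      _ = f + k * f + k := by rw [rect hDf hkf (trans (right hfk))]
  -- The product `(e + k) * (f + k)` expands in two orders. As addition is not commutative, the two
  -- inner terms appear swapped, and collapsing each expansion links `e * k` to `k * f`.
  have h3 : e * f + e * k + k = e * f + k * f + k := by
    calc e * f + e * k + k = e * f + k * f + e * k + k := by rw [rect hef' hek hkf]
      _ = (e + k) * (f + k) := by
        simp only [h.left_distrib, h.right_distrib, h.mul_self, h.add_assoc]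
      _ = e * f + e * k + k * f + k := by
        rw [h.right_distrib, h.left_distrib, h.left_distrib, h.mul_self, ← h.add_assoc]
      _ = _ := by rw [rect hef' hkf hek]
  have h4 : e * f + e * k = e + e * k := by
    rw [← rect he hek hef', hfe2]
  have h5 : e * f + k * f = f + k * f := by
    have : e * f + f = f := by
      calc e * f + f = e * f + (e + f) := by rw [hef]
        _ = f := by rw [← h.add_assoc, hfe1, hef]
    rw [← rect hef' hkf hDf, this]
  rw [h1, h2, ← h4, ← h5, h3]

/-- In a band semiring `𝓡⁺` is compatible with right addition. -/
theorem RPlus_add_right (h : BandLaws S) {e f : S} (hef : e + f = f) (hfe : f + e = e) (g : S) :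
    f + g + e + g = e + g := by
  -- The element `g + e + g` lies below `e`, and adding it to `e` on the right gives back `e + g`.
  have h1 := h.add_eq_add_of_RPlus hef hfe (k := g + e + g)
    (eq_add_of_add h.toIsIdempotentSemiring rfl)
  have h3 := h.add_self (e + g)
  simp only [h.add_assoc] at *
  rw [← h1, h3]

end BandLaws

/-- If a relation finer than `𝓓⁺` is the least distributive lattice congruence of an idempotent
semiring, it identifies the two sums of any two elements, and the semiring is a band semiring. -/
theorem BandLaws.of_isLeast (h : IsIdempotentSemiring S) {r : S → S → Prop}
    (hr : ∀ a b, r a b → DPlus a b) (hl : IsLeastDistributiveLatticeCongruence S r) :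
    BandLaws S ∧ ∀ a b, r (a + b) (b + a) := by
  obtain ⟨c, hc, hd, -⟩ := hl
  have hd : IsDistributiveLattice c.Quotient := hd
  have hq : ∀ {a b : S}, (a : c.Quotient) = b → r a b := fun hab => (hc _ _).1 (c.eq.1 hab)
  refine ⟨{ h with absorb_right := ?_, absorb_left := ?_ }, ?_⟩
  · intro x y
    have h1 := (hr _ _ (hq (a := x) (b := x + x * y) (hd.add_absorb x y).symm)).1
    rwa [← h.add_assoc, h.add_self] at h1
  · intro x y
    have h1 := (hr _ _ (hq (a := x) (b := x + y * x) (by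
      have := hd.add_absorb x y
      rw [hd.mul_comm] at this
      exact this.symm))).1
    rwa [← h.add_assoc, h.add_self] at h1
  · exact fun a b => hq (hd.add_comm a b)

theorem isBandSemiring_iff : IsBandSemiring S ↔ BandLaws S :=
  ⟨fun h => (BandLaws.of_isLeast h.1 (fun _ _ h => h) h.2).1,
    fun h => ⟨h.toIsIdempotentSemiring, h.isLeast⟩⟩

/-- If `𝓛⁺` has a commutative quotient, then `a + b` and `b + a` are `𝓛⁺`-related, which is the
extra law; conversely the law turns the definition of `𝓓⁺` into that of `𝓛⁺`. -/
theorem isLeftBandSemiring_iff :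
    IsLeftBandSemiring S ↔ BandLaws S ∧ ∀ a b : S, a + b + a = a + b := by
  constructor
  · rintro ⟨h, hl⟩
    obtain ⟨h1, h2⟩ := BandLaws.of_isLeast h (r := LPlus) (fun a b hab => by
      simp only [DPlus, hab.1, hab.2, h.add_self, and_self]) hl
    refine ⟨h1, fun a b => ?_⟩
    have h3 := (h2 a b).1
    rwa [← h.add_assoc, h.add_assoc a b b, h.add_self] at h3
  · rintro ⟨h, hl⟩
    have : LPlus (S := S) = DPlus := by
      funext a b
      simp only [LPlus, DPlus, hl]
    exact ⟨h.toIsIdempotentSemiring, this ▸ h.isLeast⟩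

theorem isRightBandSemiring_iff :
    IsRightBandSemiring S ↔ BandLaws S ∧ ∀ a b : S, a + b + a = b + a := by
  constructor
  · rintro ⟨h, hl⟩
    obtain ⟨h1, h2⟩ := BandLaws.of_isLeast h (r := RPlus) (fun a b hab => by
      simp only [DPlus, hab.1, hab.2, and_self]) hl
    refine ⟨h1, fun a b => ?_⟩
    have h3 := (h2 a b).1
    rwa [← h.add_assoc, h.add_assoc a b b, h.add_self] at h3
  · rintro ⟨h, hl⟩
    have : RPlus (S := S) = DPlus := by
      funext a b
      simp only [RPlus, DPlus, hl, eq_iff_iff]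
      exact and_comm
    exact ⟨h.toIsIdempotentSemiring, this ▸ h.isLeast⟩
end Band

/-! ### Left and right congruences of a band orthoring -/

section Decomposition

variable {S : Type u} [Add S] [Mul S] [Neg S]

/-- The idempotent of the maximal additive subgroup containing `x`. -/
def idem (x : S) : S := x + -x

/-- Identities which suffice to decompose a band orthoring into a left and a right one. They are
invariant under reversing the addition. -/
structure OrthoringLaws (S : Type u) [Add S] [Mul S] [Neg S] : Prop
    extends IsSemiring S, IsInverseOperation S where
  mul_idem_self : ∀ x : S, x * idem x = idem x
  idem_mul_self : ∀ x : S, idem x * x = idem x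
  add_idem_self : ∀ x y : S, idem x + idem y + (idem x + idem y) = idem x + idem y
  absorb_right : ∀ x y : S, idem x + idem x * idem y + idem x = idem x
  absorb_left : ∀ x y : S, idem x + idem y * idem x + idem x = idem x

namespace OrthoringLaws

theorem idem_add (h : OrthoringLaws S) (x : S) : idem x + x = x := h.add_neg_add x

theorem add_idem (h : OrthoringLaws S) (x : S) : x + idem x = x := by
  rw [idem, h.add_neg_comm, ← h.add_assoc, h.add_neg_add]

theorem neg_add_idem (h : OrthoringLaws S) (x : S) : -x + idem x = -x := by
  have := h.add_neg_add (-x)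
  rwa [h.neg_neg, h.add_assoc] at this

theorem idem_add_idem (h : OrthoringLaws S) (x : S) : idem x + idem x = idem x := by
  nth_rw 2 [idem]
  rw [← h.add_assoc, h.idem_add, idem]

theorem idem_eq (h : OrthoringLaws S) {x y e : S} (hx : x + e = x) (hy : x + y = e) :
    idem x = e := by
  have h1 : idem x + e = idem x := by rw [idem, h.add_neg_comm, h.add_assoc, hx]
  have h2 : idem x + e = e := by rw [← hy, ← h.add_assoc, h.idem_add]
  exact h1.symm.trans h2

theorem idem_eq_self (h : OrthoringLaws S) {e : S} (he : e + e = e) : idem e = e :=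
  h.idem_eq he he

theorem neg_eq (h : OrthoringLaws S) {x y : S} (hx : x + y = idem x) (hy : idem x + y = y) :
    -x = y := by
  calc -x = -x + (x + y) := by rw [hx, h.neg_add_idem]
    _ = y := by rw [← h.add_assoc, ← h.add_neg_comm]; exact hy

/-- Right multiplication by `y` is an additive homomorphism, so it maps the additive subgroup around
`x` into one around `x * y`. -/
theorem idem_mul (h : OrthoringLaws S) (x y : S) : idem (x * y) = idem x * y :=
  h.idem_eq (y := -x * y) (by rw [← h.right_distrib, h.add_idem])
    (by rw [← h.right_distrib, idem])

theorem idem_mul' (h : OrthoringLaws S) (x y : S) : idem (x * y) = x * idem y :=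
  h.idem_eq (y := x * -y) (by rw [← h.left_distrib, h.add_idem])
    (by rw [← h.left_distrib, idem])

theorem idem_idem (h : OrthoringLaws S) (x : S) : idem (idem x) = idem x :=
  h.idem_eq_self (h.idem_add_idem x)

theorem idem_mul_idem (h : OrthoringLaws S) (x y : S) : idem x * idem y = idem (x * y) := by
  rw [← h.idem_mul', ← h.idem_mul, h.idem_idem]

/-- This fails for general unions of groups with idempotents closed under addition; multiplication
supplies it. Expanding `idem (a + b) = (a + b) * idem (a + b)` leaves an expression in `idem a` and
`idem b` only, namely the square of `idem a + idem b`, and additive idempotents are multiplicatively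
idempotent. -/
theorem idem_add_eq (h : OrthoringLaws S) (x y : S) : idem (x + y) = idem x + idem y := by
  have key : ∀ a b : S, idem (a + b) = idem a + idem (a * b) + (idem (b * a) + idem b) := by
    intro a b
    calc idem (a + b) = (a + b) * idem (a + b) := (h.mul_idem_self _).symm
      _ = a * idem (a + b) + b * idem (a + b) := h.right_distrib _ _ _
      _ = _ := by
        rw [← h.idem_mul', ← h.idem_mul', h.idem_mul, h.idem_mul, h.left_distrib,
          h.left_distrib, h.idem_mul_self, h.idem_mul_self, h.idem_mul, h.idem_mul]
  have hsq : ∀ a : S, idem a * idem a = idem a := fun a => by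
    rw [← h.idem_mul', h.idem_mul_self, h.idem_idem]
  rw [key]
  calc _ = idem x * idem x + idem x * idem y + (idem y * idem x + idem y * idem y) := by
        rw [hsq, hsq, h.idem_mul_idem, h.idem_mul_idem]
    _ = (idem x + idem y) * (idem x + idem y) := by
        rw [h.right_distrib, h.left_distrib, h.left_distrib]
    _ = _ := by
      have h1 := h.mul_idem_self (idem x + idem y)
      rwa [h.idem_eq_self (h.add_idem_self x y)] at h1

/-- The additive idempotents as a subsemiring. -/
def idempotents (h : OrthoringLaws S) : Subsemiring S where
  carrier := addIdempotents S
  add_mem := fun x hx y hy => by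
    have := h.add_idem_self x y
    rwa [h.idem_eq_self hx, h.idem_eq_self hy] at this
  mul_mem := fun x hx y hy => by
    change x * y + x * y = x * y
    rw [← h.left_distrib, show y + y = y from hy]

theorem bandLaws (h : OrthoringLaws S) : BandLaws h.idempotents.Elem where
  add_assoc x y z := Subtype.ext (h.add_assoc x.1 y.1 z.1)
  mul_assoc x y z := Subtype.ext (h.mul_assoc x.1 y.1 z.1)
  left_distrib x y z := Subtype.ext (h.left_distrib x.1 y.1 z.1)
  right_distrib x y z := Subtype.ext (h.right_distrib x.1 y.1 z.1)
  add_self x := Subtype.ext x.2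
  mul_self x := Subtype.ext (by
    have := h.mul_idem_self x.1
    rwa [h.idem_eq_self x.2] at this)
  absorb_right x y := Subtype.ext (by
    have := h.absorb_right x.1 y.1
    rwa [h.idem_eq_self x.2, h.idem_eq_self y.2] at this)
  absorb_left x y := Subtype.ext (by
    have := h.absorb_left x.1 y.1
    rwa [h.idem_eq_self x.2, h.idem_eq_self y.2] at this)

theorem idem_add_left (h : OrthoringLaws S) {a b : S} (h1 : a = b + idem a) :
    idem b + idem a = idem a := by
  conv_rhs => rw [h1]
  rw [h.idem_add_eq, h.idem_idem]

theorem idem_RPlus_add (h : OrthoringLaws S) {a b : S} (h1 : idem a + idem b = idem b)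
    (h2 : idem b + idem a = idem a) (c : S) :
    idem b + idem c + idem a + idem c = idem a + idem c :=
  congrArg Subtype.val (h.bandLaws.RPlus_add_right (e := ⟨idem a, h.idem_add_idem a⟩)
    (f := ⟨idem b, h.idem_add_idem b⟩) (Subtype.ext h1) (Subtype.ext h2)
    ⟨idem c, h.idem_add_idem c⟩)

/-- The hard half of compatibility with addition, where regularity of the band `E⁺` enters through
`idem_RPlus_add`. -/
theorem add_right_compat (h : OrthoringLaws S) {a b : S} (h1 : a = b + idem a)
    (h2 : b = a + idem b) (c : S) : a + c = b + c + idem (a + c) := by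
  have hba := h.idem_add_left h1
  have hab := h.idem_add_left h2
  have hreg := h.idem_RPlus_add hab hba c
  have hac : a + c = a + (idem a + c) := by rw [← h.add_assoc, h.add_idem]
  have hself := h.add_idem (idem a + c)
  rw [h.idem_add_eq, h.idem_idem] at hself
  -- it remains to compare `idem a + c` with `idem b + c + idem a + idem c`
  have key : idem b + c + (idem a + idem c) = idem a + c := by
    have hx := h.idem_add (c + (idem a + idem c))
    rw [h.idem_add_eq, h.idem_add_eq, h.idem_idem, h.idem_idem] at hx
    -- Both sides of `key` are written as an idempotent plus the common tail `c + (idem a + idem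
    -- c)`, so that only idempotents remain to be compared.
    have e1 : idem b + c + (idem a + idem c) = idem b + idem c + idem a + idem c +
        (c + (idem a + idem c)) := by
      rw [h.add_assoc, ← hx]
      have := h.idem_add_idem c
      simp only [h.add_assoc] at *
      grind
    have e2 : idem a + c = idem a + idem c + (c + (idem a + idem c)) := by
      rw [h.add_assoc (idem a), ← h.add_assoc (idem c), h.idem_add, ← h.add_assoc, hself]
    rw [e1, e2, hreg]
  calc a + c = a + (idem a + c) := hac
    _ = a + idem b + c + (idem a + idem c) := by rw [← key]; simp only [h.add_assoc]
    _ = _ := by rw [← h2, h.idem_add_eq]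

theorem add_left_compat (h : OrthoringLaws S) {a b : S} (h1 : a = b + idem a) (c : S) :
    c + a = c + b + idem (c + a) := by
  have hba := h.idem_add_left h1
  have hx := h.add_idem (c + b)
  rw [h.idem_add_eq] at hx ⊢
  calc c + a = c + b + idem a := by rw [h.add_assoc, ← h1]
    _ = c + b + (idem c + idem b) + idem a := by rw [hx]
    _ = _ := by rw [h.add_assoc (c + b), h.add_assoc (idem c), hba]

theorem idem_neg (h : OrthoringLaws S) (a : S) : idem (-a) = idem a := by
  rw [idem, h.neg_neg, idem, h.add_neg_comm]

theorem neg_compat (h : OrthoringLaws S) {a b : S} (h1 : a = b + idem a)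
    (h2 : b = a + idem b) : -a = -b + idem a := by
  have hba := h.idem_add_left h1
  have hab := h.idem_add_left h2
  have hb : idem b + -b = -b := by
    have := h.idem_add (-b)
    rwa [h.idem_neg] at this
  refine h.neg_eq ?_ ?_
  · calc a + (-b + idem a) = b + (idem a + (idem b + -b)) + idem a := by
          rw [hb]; nth_rw 1 [h1]; simp only [h.add_assoc]
      _ = idem a := by rw [← h.add_assoc (idem a), hab, hb]; exact hba
  · calc idem a + (-b + idem a) = idem a + idem b + -b + idem a := by
          rw [h.add_assoc (idem a) (idem b), hb, h.add_assoc]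
      _ = _ := by rw [hab, hb]

theorem trans_compat (h : OrthoringLaws S) {a b c : S} (h1 : a = b + idem a) (h2 : b = c + idem b) :
    a = c + idem a := by
  rw [← h.idem_add_left h1, ← h.add_assoc, ← h2]
  exact h1

theorem mul_left_compat (h : OrthoringLaws S) {a b : S} (h1 : a = b + idem a) (c : S) :
    c * a = c * b + idem (c * a) := by
  rw [h.idem_mul', ← h.left_distrib, ← h1]

theorem mul_right_compat (h : OrthoringLaws S) {a b : S} (h1 : a = b + idem a) (c : S) :
    a * c = b * c + idem (a * c) := by
  rw [h.idem_mul, ← h.right_distrib, ← h1]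

/-- The congruence whose quotient is the left component of a band orthoring. -/
def leftCongruence (h : OrthoringLaws S) : RingCon S where
  r a b := a = b + idem a ∧ b = a + idem b
  iseqv := ⟨fun x => ⟨(h.add_idem x).symm, (h.add_idem x).symm⟩, fun h => ⟨h.2, h.1⟩,
      fun h1 h2 => ⟨h.trans_compat h1.1 h2.1, h.trans_compat h2.2 h1.2⟩⟩
  mul' {_ b c _} h1 h2 :=
    ⟨h.trans_compat (h.mul_right_compat h1.1 c) (h.mul_left_compat h2.1 b),
      h.trans_compat (h.mul_left_compat h2.2 b) (h.mul_right_compat h1.2 c)⟩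
  add' {_ b c _} h1 h2 :=
    ⟨h.trans_compat (h.add_right_compat h1.1 h1.2 c) (h.add_left_compat h2.1 b),
      h.trans_compat (h.add_left_compat h2.2 b) (h.add_right_compat h1.2 h1.1 c)⟩

/-! ### Duality under reversal of addition -/

theorem idem_op (h : OrthoringLaws S) (x : S) :
    idem (AddOpposite.op x) = AddOpposite.op (idem x) := by
  rw [idem, idem, h.add_neg_comm]; rfl

/-- The identities are invariant under reversing the addition. -/
theorem addOpposite (h : OrthoringLaws S) : OrthoringLaws Sᵃᵒᵖ := by
  have op : ∀ x : Sᵃᵒᵖ, idem x = AddOpposite.op (idem x.unop) := fun x => h.idem_op x.unop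
  refine
    { add_assoc := fun x y z => AddOpposite.unop_injective (h.add_assoc _ _ _).symm
      mul_assoc := fun x y z => AddOpposite.unop_injective (h.mul_assoc _ _ _)
      left_distrib := fun x y z => AddOpposite.unop_injective (h.left_distrib _ _ _)
      right_distrib := fun x y z => AddOpposite.unop_injective (h.right_distrib _ _ _)
      add_neg_add := fun x => AddOpposite.unop_injective
        ((h.add_assoc _ _ _).symm.trans (h.add_neg_add x.unop))
      add_neg_comm := fun x => AddOpposite.unop_injective (h.add_neg_comm x.unop).symm
      neg_neg := fun x => AddOpposite.unop_injective (h.neg_neg x.unop)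
      mul_idem_self := ?_, idem_mul_self := ?_, add_idem_self := ?_
      absorb_right := ?_, absorb_left := ?_ } <;> intros <;> simp only [op]
  · exact AddOpposite.unop_injective (h.mul_idem_self _)
  · exact AddOpposite.unop_injective (h.idem_mul_self _)
  · exact AddOpposite.unop_injective (h.add_idem_self _ _)
  · exact AddOpposite.unop_injective ((h.add_assoc _ _ _).symm.trans (h.absorb_right _ _))
  · exact AddOpposite.unop_injective ((h.add_assoc _ _ _).symm.trans (h.absorb_left _ _))

/-- The congruence whose quotient is the right component of a band orthoring. -/
def rightCongruence (h : OrthoringLaws S) : RingCon S where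
  r a b := h.addOpposite.leftCongruence (AddOpposite.op a) (AddOpposite.op b)
  iseqv := ⟨fun _ => RingCon.refl _ _, fun h => RingCon.symm _ h,
    fun h1 h2 => RingCon.trans _ h1 h2⟩
  mul' h1 h2 := RingCon.mul _ h1 h2
  add' h1 h2 := RingCon.add _ h2 h1

theorem leftCongruence_iff (h : OrthoringLaws S) {a b : S} :
    h.leftCongruence a b ↔ a = b + idem a ∧ b = a + idem b := Iff.rfl

theorem rightCongruence_iff (h : OrthoringLaws S) {a b : S} :
    h.rightCongruence a b ↔ a = idem a + b ∧ b = idem b + a := by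
  have : h.rightCongruence a b ↔ AddOpposite.op a = AddOpposite.op b + idem (AddOpposite.op a) ∧
    AddOpposite.op b = AddOpposite.op a + idem (AddOpposite.op b) := Iff.rfl
  rw [this, h.idem_op, h.idem_op, ← AddOpposite.op_add, ← AddOpposite.op_add,
    AddOpposite.op_injective.eq_iff, AddOpposite.op_injective.eq_iff]

theorem leftCongruence_neg (h : OrthoringLaws S) {a b : S} (hab : h.leftCongruence a b) :
    h.leftCongruence (-a) (-b) := by
  obtain ⟨h1, h2⟩ := hab
  refine ⟨?_, ?_⟩ <;> rw [h.idem_neg]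
  exacts [h.neg_compat h1 h2, h.neg_compat h2 h1]

theorem rightCongruence_neg (h : OrthoringLaws S) {a b : S} (hab : h.rightCongruence a b) :
    h.rightCongruence (-a) (-b) :=
  h.addOpposite.leftCongruence_neg hab

/-- The idempotents `idem a` and `idem b` are both `𝓡⁺`- and `𝓛⁺`-related, hence equal, and then `a
= b + idem b = b`. -/
theorem eq_of_congruence (h : OrthoringLaws S) {a b : S} (h1 : h.leftCongruence a b)
    (h2 : h.rightCongruence a b) : a = b := by
  rw [leftCongruence_iff] at h1
  rw [rightCongruence_iff] at h2
  have h3 := h.idem_add_left h1.1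
  have h4 : idem b = idem b + idem a := by
    conv_lhs => rw [h2.2]
    rw [h.idem_add_eq, h.idem_idem]
  have h5 : idem a = idem b := h3.symm.trans h4.symm
  rw [h1.1, h5, h.add_idem]

end OrthoringLaws
end Decomposition

/-! ### Equational descriptions of the three classes -/

section Variety

/-- Replace every variable of a term by the first one. -/
def Term.collapse : Term → Term
  | .var _ => .var 0
  | .add s t => .add s.collapse t.collapse
  | .mul s t => .mul s.collapse t.collapse
  | .neg t => .neg t.collapse

theorem Term.eval_collapse {S : Type u} [Add S] [Mul S] [Neg S] (v : ℕ → S) (t : Term) :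
    t.collapse.eval v = t.eval (fun _ => v 0) := by
  induction t with
  | var => rfl
  | add s t hs ht => simp only [collapse, eval, hs, ht]
  | mul s t hs ht => simp only [collapse, eval, hs, ht]
  | neg t ht => simp only [collapse, eval, ht]

/-- The identities of band orthorings. The first three say that the terms in an element `x` form
a ring. -/
structure BandOrthoringLaws (S : Type u) [Add S] [Mul S] [Neg S] : Prop
    extends IsSemiring S, IsInverseOperation S where
  eval_add_comm : ∀ (x : S) (s t : Term),
    s.eval (fun _ => x) + t.eval (fun _ => x) = t.eval (fun _ => x) + s.eval (fun _ => x)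
  idem_add_eval : ∀ (x : S) (t : Term), idem x + t.eval (fun _ => x) = t.eval (fun _ => x)
  idem_eval : ∀ (x : S) (t : Term), idem (t.eval (fun _ => x)) = idem x
  add_idem_self : ∀ x y : S, idem x + idem y + (idem x + idem y) = idem x + idem y
  absorb_right : ∀ x y : S, idem x + idem x * idem y + idem x = idem x
  absorb_left : ∀ x y : S, idem x + idem y * idem x + idem x = idem x

namespace BandOrthoringLaws

variable {S : Type u} [Add S] [Mul S] [Neg S]

theorem orthoringLaws (h : BandOrthoringLaws S) : OrthoringLaws S := by
  have idem_add_idem : ∀ x : S, idem x + idem x = idem x := fun x =>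
    h.idem_add_eval x (.add (.var 0) (.neg (.var 0)))
  -- A ring has only one additive idempotent, its zero.
  have eval_eq : ∀ (x : S) (t : Term),
      t.eval (fun _ => x) + t.eval (fun _ => x) = t.eval (fun _ => x) →
        t.eval (fun _ => x) = idem x := by
    intro x t ht
    have h1 := h.idem_eval x t
    have h2 := h.add_neg_add (t.eval (fun _ => x))
    rw [h.add_assoc, ← h.add_neg_comm, ← h.add_assoc, ht] at h2
    exact h2.symm.trans h1
  refine { h with mul_idem_self := fun x => ?_, idem_mul_self := fun x => ?_ }
  · refine eval_eq x (.mul (.var 0) (.add (.var 0) (.neg (.var 0)))) ?_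
    change x * idem x + x * idem x = x * idem x
    rw [← h.left_distrib, idem_add_idem]
  · refine eval_eq x (.mul (.add (.var 0) (.neg (.var 0))) (.var 0)) ?_
    change idem x * x + idem x * x = idem x * x
    rw [← h.right_distrib, idem_add_idem]

theorem isCompletelyRegular (h : BandOrthoringLaws S) : IsCompletelyRegular S := by
  refine { h with union_of_rings := fun x => ?_ }
  -- The values of terms at `x` form the subalgebra generated by `x`; its zero is `idem x`.
  let R : Subsemiring S :=
    { carrier := Set.range fun t : Term => t.eval (fun _ => x)
      add_mem := by rintro _ ⟨s, rfl⟩ _ ⟨t, rfl⟩; exact ⟨.add s t, rfl⟩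
      mul_mem := by rintro _ ⟨s, rfl⟩ _ ⟨t, rfl⟩; exact ⟨.mul s t, rfl⟩ }
  refine ⟨R, ⟨.var 0, rfl⟩,
    { add_assoc := fun a b c => Subtype.ext (h.add_assoc a.1 b.1 c.1)
      mul_assoc := fun a b c => Subtype.ext (h.mul_assoc a.1 b.1 c.1)
      left_distrib := fun a b c => Subtype.ext (h.left_distrib a.1 b.1 c.1)
      right_distrib := fun a b c => Subtype.ext (h.right_distrib a.1 b.1 c.1)
      add_comm := ?_
      exists_zero_neg := ⟨⟨idem x, .add (.var 0) (.neg (.var 0)), rfl⟩, ?_, ?_⟩ }⟩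
  · rintro ⟨_, s, rfl⟩ ⟨_, t, rfl⟩; exact Subtype.ext (h.eval_add_comm x s t)
  · rintro ⟨_, t, rfl⟩; exact Subtype.ext (h.idem_add_eval x t)
  · rintro ⟨_, t, rfl⟩; exact ⟨⟨_, .neg t, rfl⟩, Subtype.ext (h.idem_eval x t)⟩

end BandOrthoringLaws

variable {S : Type u} [Add S] [Mul S] [Neg S]

/-- The identities of rings hold for the terms in an element of a completely regular semiring. -/
theorem IsCompletelyRegular.eval_laws (h : IsCompletelyRegular S) (hn : IsInverseOperation S)
    (x : S) :
    (∀ s t : Term, s.eval (fun _ => x) + t.eval (fun _ => x) =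
      t.eval (fun _ => x) + s.eval (fun _ => x)) ∧
    (∀ t : Term, idem x + t.eval (fun _ => x) = t.eval (fun _ => x)) ∧
    ∀ t : Term, idem (t.eval (fun _ => x)) = idem x := by
  obtain ⟨R, hx, hR⟩ := h.union_of_rings x
  obtain ⟨⟨z, hz⟩, hzero, hneg⟩ := hR.exists_zero_neg
  have comm : ∀ a ∈ R.carrier, ∀ b ∈ R.carrier, a + b = b + a := fun a ha b hb =>
    congrArg Subtype.val (hR.add_comm ⟨a, ha⟩ ⟨b, hb⟩)
  have zero : ∀ a ∈ R.carrier, z + a = a := fun a ha => congrArg Subtype.val (hzero ⟨a, ha⟩)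
  -- The global negation restricts to the negation of any ring `R` containing `x`, so `R` contains
  -- every term in `x`.
  have key : ∀ a ∈ R.carrier, idem a = z ∧ -a ∈ R.carrier := by
    intro a ha
    obtain ⟨⟨b, hb⟩, hab⟩ := hneg ⟨a, ha⟩
    have hab : a + b = z := congrArg Subtype.val hab
    have h1 : idem a = z := by
      have h2 : idem a + z = z := by rw [← hab, ← h.add_assoc, idem, hn.add_neg_add]
      have h3 : idem a + z = idem a := by
        rw [idem, hn.add_neg_comm, h.add_assoc, comm a ha z hz, zero a ha]
      exact h3.symm.trans h2
    refine ⟨h1, ?_⟩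
    have h2 : -a = b := by
      have h3 := hn.add_neg_add (-a)
      rw [hn.neg_neg, h.add_assoc, show a + -a = z from h1, ← hab, ← h.add_assoc,
        ← hn.add_neg_comm, show a + -a = z from h1, zero b hb] at h3
      exact h3.symm
    exact h2 ▸ hb
  have mem : ∀ t : Term, t.eval (fun _ => x) ∈ R.carrier := by
    intro t
    induction t with
    | var => exact hx
    | add s t hs ht => exact R.add_mem _ hs _ ht
    | mul s t hs ht => exact R.mul_mem _ hs _ ht
    | neg t ht => exact (key _ ht).2
  refine ⟨fun s t => comm _ (mem s) _ (mem t), fun t => ?_, fun t => ?_⟩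
  · rw [(key x hx).1, zero _ (mem t)]
  · rw [(key x hx).1, (key _ (mem t)).1]

theorem idem_mem_addIdempotents (h : IsSemiring S) (hn : IsInverseOperation S) (x : S) :
    idem x ∈ addIdempotents S := by
  change x + -x + (x + -x) = x + -x
  rw [← h.add_assoc, hn.add_neg_add]

theorem BandOrthoringLaws.of_bandLaws (h : IsCompletelyRegular S) (hn : IsInverseOperation S)
    {T : Subsemiring S} (hT : T.carrier = addIdempotents S) (hb : BandLaws T.Elem) :
    BandOrthoringLaws S := by
  have mem : ∀ x : S, idem x ∈ T.carrier := fun x =>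
    hT ▸ idem_mem_addIdempotents h.toIsSemiring hn x
  exact
    { h, hn with
      eval_add_comm := fun x => (h.eval_laws hn x).1
      idem_add_eval := fun x => (h.eval_laws hn x).2.1
      idem_eval := fun x => (h.eval_laws hn x).2.2
      add_idem_self := fun x y =>
        congrArg Subtype.val (hb.add_self (⟨idem x, mem x⟩ + ⟨idem y, mem y⟩))
      absorb_right := fun x y =>
        congrArg Subtype.val (hb.absorb_right ⟨idem x, mem x⟩ ⟨idem y, mem y⟩)
      absorb_left := fun x y =>
        congrArg Subtype.val (hb.absorb_left ⟨idem x, mem x⟩ ⟨idem y, mem y⟩) }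

theorem mem_BOR_iff {A : Alg.{u}} : A ∈ BOR ↔ BandOrthoringLaws A.carrier := by
  constructor
  · rintro ⟨⟨h, T, hT, hb⟩, hn⟩
    exact .of_bandLaws h hn hT (isBandSemiring_iff.1 hb)
  · intro h
    exact ⟨⟨h.isCompletelyRegular, h.orthoringLaws.idempotents, rfl,
      isBandSemiring_iff.2 h.orthoringLaws.bandLaws⟩, h.toIsInverseOperation⟩

theorem mem_LBOR_iff {A : Alg.{u}} : A ∈ LBOR ↔ BandOrthoringLaws A.carrier ∧
    ∀ x y : A.carrier, idem x + idem y + idem x = idem x + idem y := by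
  constructor
  · rintro ⟨⟨h, T, hT, hb⟩, hn⟩
    obtain ⟨hb, hl⟩ := isLeftBandSemiring_iff.1 hb
    have mem : ∀ x : A.carrier, idem x ∈ T.carrier := fun x =>
      hT ▸ idem_mem_addIdempotents h.toIsSemiring hn x
    exact ⟨.of_bandLaws h hn hT hb, fun x y =>
      congrArg Subtype.val (hl ⟨idem x, mem x⟩ ⟨idem y, mem y⟩)⟩
  · rintro ⟨h, hl⟩
    refine ⟨⟨h.isCompletelyRegular, h.orthoringLaws.idempotents, rfl,
      isLeftBandSemiring_iff.2 ⟨h.orthoringLaws.bandLaws, fun x y => Subtype.ext ?_⟩⟩,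
      h.toIsInverseOperation⟩
    have := hl x.1 y.1
    rwa [h.orthoringLaws.idem_eq_self x.2, h.orthoringLaws.idem_eq_self y.2] at this

theorem mem_RBOR_iff {A : Alg.{u}} : A ∈ RBOR ↔ BandOrthoringLaws A.carrier ∧
    ∀ x y : A.carrier, idem x + idem y + idem x = idem y + idem x := by
  constructor
  · rintro ⟨⟨h, T, hT, hb⟩, hn⟩
    obtain ⟨hb, hl⟩ := isRightBandSemiring_iff.1 hb
    have mem : ∀ x : A.carrier, idem x ∈ T.carrier := fun x =>
      hT ▸ idem_mem_addIdempotents h.toIsSemiring hn x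
    exact ⟨.of_bandLaws h hn hT hb, fun x y =>
      congrArg Subtype.val (hl ⟨idem x, mem x⟩ ⟨idem y, mem y⟩)⟩
  · rintro ⟨h, hl⟩
    refine ⟨⟨h.isCompletelyRegular, h.orthoringLaws.idempotents, rfl,
      isRightBandSemiring_iff.2 ⟨h.orthoringLaws.bandLaws, fun x y => Subtype.ext ?_⟩⟩,
      h.toIsInverseOperation⟩
    have := hl x.1 y.1
    rwa [h.orthoringLaws.idem_eq_self x.2, h.orthoringLaws.idem_eq_self y.2] at this

/-- The term `x + -x`. -/
def Term.idem (t : Term) : Term := .add t (.neg t)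

/-- The assignment sending the first three variables to the given values. -/
def assign {S : Type u} (x y z : S) : ℕ → S
  | 0 => x
  | 1 => y
  | _ => z

/-- An algebra satisfying every identity of band orthorings satisfies their defining laws. -/
theorem BandOrthoringLaws.of_identities {A : Alg.{u}} {K : Set Alg.{u}}
    (hK : ∀ B ∈ K, BandOrthoringLaws B.carrier)
    (hA : ∀ p, (∀ B ∈ K, Satisfies B p) → Satisfies A p) : BandOrthoringLaws A.carrier where
  add_assoc x y z := hA (.add (.add (.var 0) (.var 1)) (.var 2),
    .add (.var 0) (.add (.var 1) (.var 2))) (fun B hB v => (hK B hB).add_assoc _ _ _) (assign x y z)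
  mul_assoc x y z := hA (.mul (.mul (.var 0) (.var 1)) (.var 2),
    .mul (.var 0) (.mul (.var 1) (.var 2))) (fun B hB v => (hK B hB).mul_assoc _ _ _) (assign x y z)
  left_distrib x y z := hA (.mul (.var 0) (.add (.var 1) (.var 2)),
    .add (.mul (.var 0) (.var 1)) (.mul (.var 0) (.var 2)))
    (fun B hB v => (hK B hB).left_distrib _ _ _) (assign x y z)
  right_distrib x y z := hA (.mul (.add (.var 0) (.var 1)) (.var 2),
    .add (.mul (.var 0) (.var 2)) (.mul (.var 1) (.var 2)))
    (fun B hB v => (hK B hB).right_distrib _ _ _) (assign x y z)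
  add_neg_add x := hA (.add (.add (.var 0) (.neg (.var 0))) (.var 0), .var 0)
    (fun B hB v => (hK B hB).add_neg_add _) (fun _ => x)
  add_neg_comm x := hA (.add (.var 0) (.neg (.var 0)), .add (.neg (.var 0)) (.var 0))
    (fun B hB v => (hK B hB).add_neg_comm _) (fun _ => x)
  neg_neg x := hA (.neg (.neg (.var 0)), .var 0)
    (fun B hB v => (hK B hB).neg_neg _) (fun _ => x)
  eval_add_comm x s t := by
    have := hA (.add s.collapse t.collapse, .add t.collapse s.collapse) (fun B hB v => by
      simp only [Term.eval, Term.eval_collapse]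
      exact (hK B hB).eval_add_comm _ _ _) (fun _ => x)
    simp only [Term.eval, Term.eval_collapse] at this
    exact this
  idem_add_eval x t := by
    have := hA (.add (Term.var 0).idem t.collapse, t.collapse) (fun B hB v => by
      simp only [Term.eval, Term.eval_collapse]
      exact (hK B hB).idem_add_eval _ _) (fun _ => x)
    simp only [Term.eval, Term.eval_collapse] at this
    exact this
  idem_eval x t := by
    have := hA (t.collapse.idem, (Term.var 0).idem) (fun B hB v => by
      simp only [Term.eval, Term.idem, Term.eval_collapse]
      exact (hK B hB).idem_eval _ _) (fun _ => x)
    simp only [Term.eval, Term.idem, Term.eval_collapse] at this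
    exact this
  add_idem_self x y := hA (.add (.add (Term.var 0).idem (Term.var 1).idem)
    (.add (Term.var 0).idem (Term.var 1).idem), .add (Term.var 0).idem (Term.var 1).idem)
    (fun B hB v => (hK B hB).add_idem_self _ _) (assign x y y)
  absorb_right x y := hA (.add (.add (Term.var 0).idem
    (.mul (Term.var 0).idem (Term.var 1).idem)) (Term.var 0).idem, (Term.var 0).idem)
    (fun B hB v => (hK B hB).absorb_right _ _) (assign x y y)
  absorb_left x y := hA (.add (.add (Term.var 0).idem
    (.mul (Term.var 1).idem (Term.var 0).idem)) (Term.var 0).idem, (Term.var 0).idem)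
    (fun B hB v => (hK B hB).absorb_left _ _) (assign x y y)

/-- The defining set is the full equational theory of `K`, so only the inclusion of its models in
`K` needs proof. -/
theorem isVariety_of_identities {K : Set Alg.{u}}
    (h : ∀ A, (∀ p, (∀ B ∈ K, Satisfies B p) → Satisfies A p) → A ∈ K) : IsVariety K :=
  ⟨{p | ∀ B ∈ K, Satisfies B p}, Set.Subset.antisymm (fun _ hA _ hp => hp _ hA) fun A hA => h A hA⟩

theorem isVariety_BOR : IsVariety BOR.{u} :=
  isVariety_of_identities fun _ hA =>
    mem_BOR_iff.2 (.of_identities (fun _ hB => mem_BOR_iff.1 hB) hA)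

theorem isVariety_LBOR : IsVariety LBOR.{u} :=
  isVariety_of_identities fun _ hA =>
    mem_LBOR_iff.2 ⟨.of_identities (fun _ hB => (mem_LBOR_iff.1 hB).1) hA, fun x y =>
      hA (.add (.add (Term.var 0).idem (Term.var 1).idem) (Term.var 0).idem,
        .add (Term.var 0).idem (Term.var 1).idem)
        (fun _ hB _ => (mem_LBOR_iff.1 hB).2 _ _) (assign x y y)⟩

theorem isVariety_RBOR : IsVariety RBOR.{u} :=
  isVariety_of_identities fun _ hA =>
    mem_RBOR_iff.2 ⟨.of_identities (fun _ hB => (mem_RBOR_iff.1 hB).1) hA, fun x y =>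
      hA (.add (.add (Term.var 0).idem (Term.var 1).idem) (Term.var 0).idem,
        .add (Term.var 1).idem (Term.var 0).idem)
        (fun _ hB _ => (mem_RBOR_iff.1 hB).2 _ _) (assign x y y)⟩

/-! ### Quotient algebras and the join -/

/-- The quotient of an algebra by a congruence. -/
def quotientAlg (A : Alg.{u}) (c : RingCon A.carrier) (hc : ∀ {a b}, c a b → c (-a) (-b)) :
    Alg.{u} where
  carrier := c.Quotient
  nonempty := ⟨RingCon.toQuotient (Classical.arbitrary A.carrier)⟩
  neg := ⟨Quotient.map' (fun a => -a) fun _ _ h => hc h⟩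

theorem eval_quotientAlg {A : Alg.{u}} {c : RingCon A.carrier}
    {hc : ∀ {a b}, c a b → c (-a) (-b)} (v : ℕ → A.carrier) (t : Term) :
    t.eval (S := (quotientAlg A c hc).carrier) (fun n => (v n : c.Quotient)) =
      RingCon.toQuotient (c := c) (t.eval v) := by
  induction t with
  | var => rfl
  | add s t hs ht => simp only [Term.eval, hs, ht]; rfl
  | mul s t hs ht => simp only [Term.eval, hs, ht]; rfl
  | neg t ht => simp only [Term.eval, ht]; rfl

theorem Satisfies.quotientAlg {A : Alg.{u}} {c : RingCon A.carrier}
    {hc : ∀ {a b}, c a b → c (-a) (-b)} {p : Term × Term} (h : Satisfies A p) :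
    Satisfies (quotientAlg A c hc) p := by
  intro v
  obtain ⟨w, rfl⟩ : ∃ w : ℕ → A.carrier, v = fun n => (w n : c.Quotient) :=
    ⟨fun n => Quotient.out (v n), funext fun n => (Quotient.out_eq (v n)).symm⟩
  rw [eval_quotientAlg, eval_quotientAlg, h w]

theorem Satisfies.congruence {A : Alg.{u}} {c : RingCon A.carrier}
    {hc : ∀ {a b}, c a b → c (-a) (-b)} {p : Term × Term}
    (h : Satisfies (BandOrthoring.quotientAlg A c hc) p) (v : ℕ → A.carrier) :
    c (p.1.eval v) (p.2.eval v) := by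
  have := h fun n => (v n : c.Quotient)
  rw [eval_quotientAlg, eval_quotientAlg] at this
  exact c.eq.1 this

theorem quotientAlg_mem_BOR {A : Alg.{u}} {c : RingCon A.carrier}
    {hc : ∀ {a b}, c a b → c (-a) (-b)} (h : A ∈ BOR) : quotientAlg A c hc ∈ BOR := by
  obtain ⟨E, hE⟩ := isVariety_BOR.{u}
  rw [hE] at h ⊢
  exact fun p hp => (h p hp).quotientAlg

theorem left_quotient_mem_LBOR {A : Alg.{u}} (hA : A ∈ BOR) (h : OrthoringLaws A.carrier) :
    quotientAlg A h.leftCongruence h.leftCongruence_neg ∈ LBOR := by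
  refine mem_LBOR_iff.2 ⟨mem_BOR_iff.1 (quotientAlg_mem_BOR hA), ?_⟩
  rintro ⟨x⟩ ⟨y⟩
  refine (RingCon.eq _ (a := idem x + idem y + idem x) (b := idem x + idem y)).2 ?_
  have h1 := h.add_idem_self x y
  have h2 : ∀ t, idem x + (idem x + t) = idem x + t := fun t => by
    rw [← h.add_assoc, h.idem_add_idem]
  have h3 := congrArg (· + idem x) h1
  rw [h.leftCongruence_iff]
  simp only [h.idem_add_eq, h.idem_idem]
  simp only [h.add_assoc, h2] at *
  -- In any band `e + f + e` and `e + f` are `𝓡⁺`-related.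
  constructor <;> grind

theorem right_quotient_mem_RBOR {A : Alg.{u}} (hA : A ∈ BOR) (h : OrthoringLaws A.carrier) :
    quotientAlg A h.rightCongruence h.rightCongruence_neg ∈ RBOR := by
  refine mem_RBOR_iff.2 ⟨mem_BOR_iff.1 (quotientAlg_mem_BOR hA), ?_⟩
  rintro ⟨x⟩ ⟨y⟩
  refine (RingCon.eq _ (a := idem x + idem y + idem x) (b := idem y + idem x)).2 ?_
  have h1 := h.add_idem_self y x
  have h2 : ∀ t, idem x + (idem x + t) = idem x + t := fun t => by
    rw [← h.add_assoc, h.idem_add_idem]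
  have h3 := congrArg (· + idem x) h1
  rw [h.rightCongruence_iff]
  simp only [h.idem_add_eq, h.idem_idem]
  simp only [h.add_assoc, h2] at *
  constructor <;> grind

theorem BOR_eq_varietyJoin : BOR.{u} = varietyJoin LBOR.{u} RBOR.{u} := by
  apply Set.Subset.antisymm
  · rintro A hA V ⟨⟨E, rfl⟩, hL, hR⟩ p hp v
    have h := (mem_BOR_iff.1 hA).orthoringLaws
    -- Both quotients satisfy the identity, so its two sides are related by both congruences in `A`
    -- itself.
    exact h.eq_of_congruence
      (Satisfies.congruence (hL (left_quotient_mem_LBOR hA h) p hp) v)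
      (Satisfies.congruence (hR (right_quotient_mem_RBOR hA h) p hp) v)
  · intro A hA
    exact hA BOR ⟨isVariety_BOR, fun B hB => mem_BOR_iff.2 (mem_LBOR_iff.1 hB).1,
      fun B hB => mem_BOR_iff.2 (mem_RBOR_iff.1 hB).1⟩

end Variety

end BandOrthoring

theorem mainTheorem9 :
    BandOrthoring.IsVariety BandOrthoring.BOR.{u} ∧
    BandOrthoring.IsVariety BandOrthoring.LBOR.{u} ∧
    BandOrthoring.IsVariety BandOrthoring.RBOR.{u} ∧
    BandOrthoring.BOR.{u} =
      BandOrthoring.varietyJoin BandOrthoring.LBOR.{u} BandOrthoring.RBOR.{u} :=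
  ⟨BandOrthoring.isVariety_BOR, BandOrthoring.isVariety_LBOR, BandOrthoring.isVariety_RBOR,
    BandOrthoring.BOR_eq_varietyJoin⟩
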